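/- An MPMAB instance consists of $M\ge 1$ players, $K\ge 1$ arms and, for each player $p\in[M]$ and arm $i\in[K]$, a reward distribution $\mathcal D_i^p$ supported in $[0,1]$ with mean $\mu_i^p$. It is an $\epsilon$-MPMAB instance, $\epsilon\in[0,1]$, if $|\mu_i^p-\mu_i^q|\le\epsilon$ for all $i\in[K]$ and $p,q\in[M]$. Put $\mu_*^p=\max_i\mu_i^p$, $\Delta_i^p=\mu_*^p-\mu_i^p$, $\Delta_i^{\min}=\min_p\Delta_i^p$, and let $\mathcal I_\epsilon=\{i\in[K]:\exists p\in[M],\ \Delta_i^p>5\epsilon\}$ be the set of subpar arms. Let $T>\max(M,K)$. In each round $t=1,\dots,T$ every player $p$ pulls an arm $i_t^p$ and, given the past and the arms pulled in round $t$, the players receive independent rewards $r_t^p\sim\mathcal D^p_{i_t^p}$; then all pulls and rewards are revealed to all players. Let $n_i^p(t)$ be the number of pulls of arm $i$ by player $p$ in the first $t$ rounds; the expected collective regret is $\mathbb E[\mathcal R(T)]=\sum_{p\in[M]}\sum_{i\in[K]}\Delta_i^p\,\mathbb E[n_i^p(T)]$. The algorithm RobustAgg$(\epsilon)$ with horizon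 $T$ acts in round $t$ as follows. For each $p$ and $i$ let $\overline n=\max(1,n_i^p(t-1))$, $\overline m=\max(1,\sum_{q\ne p}n_i^q(t-1))$, $\zeta=\frac1{\overline n}\sum_{s<t,\ i_s^p=i}r_s^p$, $\eta=\frac1{\overline m}\sum_{q\ne p}\sum_{s<t,\ i_s^q=i}r_s^q$, $$F(\lambda)=8\sqrt{13\ln T\Big[\frac{\lambda^2}{\overline n}+\frac{(1-\lambda)^2}{\overline m}\Big]}+(1-\lambda)\epsilon,\qquad \lambda^*=\operatorname*{argmin}_{\lambda\in[0,1]}F(\lambda),$$ and $\mathrm{UCB}_i^p(t)=\lambda^*\zeta+(1-\lambda^*)\eta+F(\lambda^*)$. Every player $p$ pulls an arm $i_t^p\in\operatorname{argmax}_{i\in[K]}\mathrm{UCB}_i^p(t)$, with ties broken arbitrarily. Theorem. There is an absolute constant $C>0$ such that for all $M,K\ge1$, $T>\max(M,K)$, $\epsilon\in[0,1]$ and every $\epsilon$-MPMAB instance with $M$ players and $K$ arms, the expected collective regret of RobustAgg$(\epsilon)$ run for $T$ rounds satisfies $$\mathbb E[\mathcal R(T)]\le C\left(\sum_{i\in\mathcal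 I_\epsilon}\Big(\frac{\ln T}{\Delta_i^{\min}}+M\Delta_i^{\min}\Big)+\sum_{i\in[K]\setminus\mathcal I_\epsilon}\ \sum_{p\in[M]:\,\Delta_i^p>0}\frac{\ln T}{\Delta_i^p}\right).$$ -/

import Mathlib

open MeasureTheory ProbabilityTheory

noncomputable section

/-- A multi-player multi-armed bandit instance with `M` players and `K` arms: each player `p` and
arm `i` carry a reward distribution, a probability measure on `ℝ` supported in `[0,1]`. -/
structure MPMAB (M K : ℕ) where
  dist : Fin M → Fin K → Measure ℝ
  isProb : ∀ p i, IsProbabilityMeasure (dist p i)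
  supp : ∀ p i, dist p i (Set.Icc 0 1)ᶜ = 0

attribute [instance] MPMAB.isProb

namespace MPMAB

variable {M K : ℕ} (ν : MPMAB M K)

/-- Mean reward `μ_i^p` of arm `i` for player `p`. -/
def mean (p : Fin M) (i : Fin K) : ℝ := ∫ x, x ∂(ν.dist p i)

/-- `ν` is an `ε`-MPMAB instance: the means of each arm differ by at most `ε` between players. -/
def IsDissimilar (ε : ℝ) : Prop :=
  ∀ p q : Fin M, ∀ i : Fin K, |ν.mean p i - ν.mean q i| ≤ ε

/-- Optimal mean reward `μ_*^p` of player `p`. -/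
def bestMean (p : Fin M) : ℝ := ⨆ i : Fin K, ν.mean p i

/-- Suboptimality gap `Δ_i^p = μ_*^p - μ_i^p`. -/
def gap (p : Fin M) (i : Fin K) : ℝ := ν.bestMean p - ν.mean p i

/-- `Δ_i^min`, the smallest gap of arm `i` over the players. -/
def minGap (i : Fin K) : ℝ := ⨅ p : Fin M, ν.gap p i

open Classical in
/-- The set `I_ε` of subpar arms. -/
def subpar (ε : ℝ) : Finset (Fin K) :=
  Finset.univ.filter fun i => ∃ p : Fin M, 5 * ε < ν.gap p i

end MPMAB

/-- Outcome of `n` rounds: `h s p` is the pair (arm pulled, reward observed) of player `p` in the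
`s`-th of these rounds (counted from `0`). -/
abbrev History (M K n : ℕ) : Type := Fin n → Fin M → Fin K × ℝ

namespace History

variable {M K n : ℕ} (h : History M K n)

/-- `n_i^p`: number of pulls of arm `i` by player `p`. -/
def pulls (p : Fin M) (i : Fin K) : ℕ :=
  (Finset.univ.filter fun s : Fin n => (h s p).1 = i).card

/-- `m_i^p`: number of pulls of arm `i` by the players other than `p`. -/
def otherPulls (p : Fin M) (i : Fin K) : ℕ :=
  ∑ q ∈ Finset.univ.filter (fun q : Fin M => q ≠ p), h.pulls q i

/-- Total reward collected by player `p` from arm `i`. -/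
def rewardSum (p : Fin M) (i : Fin K) : ℝ :=
  ∑ s ∈ Finset.univ.filter (fun s : Fin n => (h s p).1 = i), (h s p).2

/-- `ζ_i^p`, the empirical mean of player `p`'s own rewards from arm `i`. -/
def ownMean (p : Fin M) (i : Fin K) : ℝ :=
  1 / ((max 1 (h.pulls p i) : ℕ) : ℝ) * h.rewardSum p i

/-- `η_i^p`, the empirical mean of the other players' rewards from arm `i`. -/
def otherMean (p : Fin M) (i : Fin K) : ℝ :=
  1 / ((max 1 (h.otherPulls p i) : ℕ) : ℝ) *
    ∑ q ∈ Finset.univ.filter (fun q : Fin M => q ≠ p), h.rewardSum q i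

/-- `κ_i^p(λ) = λ ζ_i^p + (1 - λ) η_i^p`. -/
def mixMean (p : Fin M) (i : Fin K) (l : ℝ) : ℝ :=
  l * h.ownMean p i + (1 - l) * h.otherMean p i

end History

namespace RobustAgg

/-- The confidence width `F(n, m, λ, ε)`, for horizon `T`. -/
def width (T n m : ℕ) (l ε : ℝ) : ℝ :=
  8 * √(13 * Real.log T * (l ^ 2 / n + (1 - l) ^ 2 / m)) + (1 - l) * ε

theorem exists_isMinOn_width (T n m : ℕ) (ε : ℝ) :
    ∃ l ∈ Set.Icc (0 : ℝ) 1, IsMinOn (fun l => width T n m l ε) (Set.Icc 0 1) l := by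
  refine isCompact_Icc.exists_isMinOn ⟨0, by simp⟩ (Continuous.continuousOn ?_)
  unfold width
  fun_prop

/-- `λ^*`, the minimizer over `[0,1]` of the confidence width (unique when `2 ≤ T` and
`1 ≤ n, m`). -/
def optWeight (T n m : ℕ) (ε : ℝ) : ℝ := (exists_isMinOn_width T n m ε).choose

/-- The upper confidence bound `UCB_i^p` computed from the history of the previous rounds. -/
def ucb {M K k : ℕ} (T : ℕ) (ε : ℝ) (h : History M K k) (p : Fin M) (i : Fin K) : ℝ :=
  let n := max 1 (h.pulls p i)
  let m := max 1 (h.otherPulls p i)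
  let l := optWeight T n m ε
  h.mixMean p i l + width T n m l ε

end RobustAgg

/-- A (possibly randomized) multi-player bandit algorithm: `policy n` is the conditional
distribution of the arms pulled by all the players in round `n + 1`, given the history of the
first `n` rounds. -/
structure BanditAlgorithm (M K : ℕ) where
  policy : (n : ℕ) → Kernel (History M K n) (Fin M → Fin K)
  isMarkov : ∀ n, IsMarkovKernel (policy n)

attribute [instance] BanditAlgorithm.isMarkov

namespace BanditAlgorithm

variable {M K : ℕ}

/-- `A` is `RobustAgg(ε)` with horizon `T`: in each of the `T` rounds every player pulls an arm
that maximizes her upper confidence bound. Ties are broken in an arbitrary way. -/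
def IsRobustAgg (A : BanditAlgorithm M K) (T : ℕ) (ε : ℝ) : Prop :=
  ∀ n < T, ∀ h : History M K n, ∀ᵐ a ∂(A.policy n h),
    ∀ p : Fin M, ∀ j : Fin K, RobustAgg.ucb T ε h p j ≤ RobustAgg.ucb T ε h p (a p)

end BanditAlgorithm

namespace MPMAB

variable {M K : ℕ} (ν : MPMAB M K)

/-- Given the arms pulled by the players in a round, the rewards are drawn independently, that of
player `p` from the reward distribution of her arm. -/
def rewardKernel : Kernel (Fin M → Fin K) (Fin M → ℝ) where
  toFun a := Measure.pi fun p => ν.dist p (a p)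
  measurable' := measurable_of_countable _

instance : IsMarkovKernel ν.rewardKernel :=
  ⟨fun a => inferInstanceAs (IsProbabilityMeasure (Measure.pi fun p => ν.dist p (a p)))⟩

/-- Append a round with pulls `a` and rewards `r` to a history. -/
def appendRound {n : ℕ} (x : History M K n × (Fin M → Fin K) × (Fin M → ℝ)) :
    History M K (n + 1) :=
  Fin.snoc (α := fun _ => Fin M → Fin K × ℝ) x.1 fun p => (x.2.1 p, x.2.2 p)

theorem measurable_appendRound {n : ℕ} :
    Measurable (appendRound : _ → History M K (n + 1)) := by
  refine measurable_pi_lambda _ fun s => ?_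
  refine Fin.lastCases ?_ (fun s => ?_) s
  · simp only [appendRound, Fin.snoc_last]
    fun_prop
  · simp only [appendRound, Fin.snoc_castSucc]
    fun_prop

/-- Law of the history of the first `n` rounds when `A` interacts with the instance `ν`. -/
def law (A : BanditAlgorithm M K) : (n : ℕ) → Measure (History M K n)
  | 0 => Measure.dirac Fin.elim0
  | n + 1 => (law A n ⊗ₘ (A.policy n ⊗ₖ Kernel.prodMkLeft _ ν.rewardKernel)).map appendRound

instance isProbabilityMeasure_law (A : BanditAlgorithm M K) :
    (n : ℕ) → IsProbabilityMeasure (ν.law A n)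
  | 0 => inferInstanceAs (IsProbabilityMeasure (Measure.dirac Fin.elim0))
  | n + 1 => by
    have := isProbabilityMeasure_law A n
    unfold law
    exact Measure.isProbabilityMeasure_map measurable_appendRound.aemeasurable

/-- Expected regret of player `p` after `T` rounds, `∑_i Δ_i^p 𝔼[n_i^p(T)]`. -/
def expectedRegret (A : BanditAlgorithm M K) (T : ℕ) (p : Fin M) : ℝ :=
  ∑ i : Fin K, ν.gap p i * ∫ h, (h.pulls p i : ℝ) ∂(ν.law A T)

/-- Expected collective regret after `T` rounds. -/
def expectedCollectiveRegret (A : BanditAlgorithm M K) (T : ℕ) : ℝ :=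
  ∑ p : Fin M, ν.expectedRegret A T p

end MPMAB

end

/-! The centered rewards that a set `S` of players collects from one arm form a martingale in the
rounds. By Hoeffding's lemma, `exp (l * deviation - l ^ 2 / 8 * count)` has expectation at most 1
(`lintegral_exp_deviation_le`). Chernoff's bound at each fixed value of the count, and a union bound
over counts, signs, arms, players and the sets `{p}`, `{p}ᶜ`, show that a history fails to be `Good`
with probability at most `1 / T`.

On a good history `κ(λ)` is within `F(λ)` of the true mean for all `λ ∈ [0,1]`, so a pulled arm
satisfies `Δ ≤ 2 F(λ*) ≤ 2 F(λ)` for every such `λ` (`gap_le_two_mul_width`). Taking `λ = 1` bounds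
the player's own pulls by `O(ln T / Δ²)`. Taking `λ = n / (n + m)` pools all data at a bias of at
most `ε`; if `Δ > 3ε`, as for subpar arms, this bounds the pulls of all players together.

Hence a count can grow past its threshold only by the overshoot of one round or on bad histories
(`integral_count_le`). Multiplying by the gaps and summing over arms gives the regret bound. -/

namespace History

/-! ### Counts and reward sums, and their one-round updates. -/

variable {M K n : ℕ}

/-- Number of pulls of arm `i` by the players in `S`. -/
def count (S : Finset (Fin M)) (i : Fin K) (h : History M K n) : ℕ := ∑ p ∈ S, h.pulls p i

theorem pulls_eq_sum (h : History M K n) (p : Fin M) (i : Fin K) :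
    h.pulls p i = ∑ s : Fin n, if (h s p).1 = i then 1 else 0 := by
  rw [pulls, Finset.card_filter]

theorem rewardSum_eq_sum (h : History M K n) (p : Fin M) (i : Fin K) :
    h.rewardSum p i = ∑ s : Fin n, if (h s p).1 = i then (h s p).2 else 0 := by
  simp [rewardSum, Finset.sum_filter]

theorem measurable_pulls (p : Fin M) (i : Fin K) :
    Measurable fun h : History M K n => h.pulls p i := by
  simp only [pulls_eq_sum]
  refine Finset.measurable_sum _ fun s _ => Measurable.ite ?_ measurable_const measurable_const
  exact (show Measurable fun h : History M K n => (h s p).1 by fun_prop) (measurableSet_singleton i)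

theorem measurable_rewardSum (p : Fin M) (i : Fin K) :
    Measurable fun h : History M K n => h.rewardSum p i := by
  simp only [rewardSum_eq_sum]
  refine Finset.measurable_sum _ fun s _ => Measurable.ite ?_ (by fun_prop) measurable_const
  exact (show Measurable fun h : History M K n => (h s p).1 by fun_prop) (measurableSet_singleton i)

theorem measurable_count (S : Finset (Fin M)) (i : Fin K) :
    Measurable (count S i : History M K n → ℕ) :=
  Finset.measurable_sum _ fun p _ => measurable_pulls p i

theorem pulls_le (h : History M K n) (p : Fin M) (i : Fin K) : h.pulls p i ≤ n := by
  simpa [pulls] using Finset.card_filter_le (Finset.univ : Finset (Fin n)) fun s => (h s p).1 = i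

theorem count_le (S : Finset (Fin M)) (i : Fin K) (h : History M K n) :
    count S i h ≤ M * n := by
  calc count S i h ≤ ∑ _p ∈ S, n := Finset.sum_le_sum fun p _ => h.pulls_le p i
    _ ≤ M * n := by
      rw [Finset.sum_const, smul_eq_mul]
      exact Nat.mul_le_mul_right _ (by simpa using Finset.card_le_univ S)

theorem pulls_appendRound (h : History M K n) (a : Fin M → Fin K) (r : Fin M → ℝ) (p : Fin M)
    (i : Fin K) :
    (MPMAB.appendRound (h, a, r)).pulls p i = h.pulls p i + if a p = i then 1 else 0 := by
  rw [pulls_eq_sum, Fin.sum_univ_castSucc, pulls_eq_sum]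
  simp only [MPMAB.appendRound, Fin.snoc_castSucc, Fin.snoc_last]

theorem rewardSum_appendRound (h : History M K n) (a : Fin M → Fin K) (r : Fin M → ℝ) (p : Fin M)
    (i : Fin K) :
    (MPMAB.appendRound (h, a, r)).rewardSum p i =
      h.rewardSum p i + if a p = i then r p else 0 := by
  simp [rewardSum_eq_sum, Fin.sum_univ_castSucc, MPMAB.appendRound]

theorem count_appendRound (S : Finset (Fin M)) (i : Fin K) (h : History M K n)
    (a : Fin M → Fin K) (r : Fin M → ℝ) :
    count S i (MPMAB.appendRound (h, a, r)) = count S i h + ∑ p ∈ S, if a p = i then 1 else 0 := by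
  simp only [count, pulls_appendRound, Finset.sum_add_distrib]

end History

/-! ### Gaps under dissimilarity. -/

namespace MPMAB

variable {M K n : ℕ} (ν : MPMAB M K)

open History

theorem ae_mem_Icc (p : Fin M) (i : Fin K) : ∀ᵐ x ∂(ν.dist p i), x ∈ Set.Icc (0 : ℝ) 1 :=
  ν.supp p i

theorem mean_mem_Icc (p : Fin M) (i : Fin K) : ν.mean p i ∈ Set.Icc (0 : ℝ) 1 := by
  have h := ν.ae_mem_Icc p i
  have hint : Integrable (fun x : ℝ => x) (ν.dist p i) := Integrable.of_mem_Icc 0 1 (by fun_prop) h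
  constructor
  · exact integral_nonneg_of_ae (h.mono fun x hx => hx.1)
  · have := integral_mono_ae hint (integrable_const (1 : ℝ)) (h.mono fun x hx => hx.2)
    simpa [mean] using this

theorem mean_le_bestMean (p : Fin M) (i : Fin K) : ν.mean p i ≤ ν.bestMean p :=
  le_ciSup (f := fun i => ν.mean p i) (Set.finite_range _).bddAbove i

theorem exists_mean_eq_bestMean (hK : 0 < K) (p : Fin M) : ∃ i, ν.mean p i = ν.bestMean p :=
  have : Nonempty (Fin K) := ⟨⟨0, hK⟩⟩
  exists_eq_ciSup_of_finite

theorem gap_nonneg (p : Fin M) (i : Fin K) : 0 ≤ ν.gap p i :=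
  sub_nonneg.2 (ν.mean_le_bestMean p i)

theorem gap_le_one (p : Fin M) (i : Fin K) : ν.gap p i ≤ 1 := by
  obtain ⟨j, hj⟩ := ν.exists_mean_eq_bestMean i.pos p
  have h1 := (ν.mean_mem_Icc p j).2
  have h2 := (ν.mean_mem_Icc p i).1
  unfold gap
  linarith

theorem bestMean_le_add {ε : ℝ} (hν : ν.IsDissimilar ε) (hK : 0 < K) (p q : Fin M) :
    ν.bestMean p ≤ ν.bestMean q + ε := by
  obtain ⟨j, hj⟩ := ν.exists_mean_eq_bestMean hK p
  have h1 := (abs_le.1 (hν p q j)).2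
  have h2 := ν.mean_le_bestMean q j
  linarith

theorem gap_le_add {ε : ℝ} (hν : ν.IsDissimilar ε) (p q : Fin M) (i : Fin K) :
    ν.gap p i ≤ ν.gap q i + 2 * ε := by
  have h1 := ν.bestMean_le_add hν i.pos p q
  have h2 := (abs_le.1 (hν q p i)).2
  unfold gap
  linarith

theorem minGap_le (p : Fin M) (i : Fin K) : ν.minGap i ≤ ν.gap p i :=
  ciInf_le (f := fun p => ν.gap p i) (Set.finite_range _).bddBelow p

theorem exists_gap_eq_minGap (hM : 0 < M) (i : Fin K) : ∃ p, ν.gap p i = ν.minGap i :=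
  have : Nonempty (Fin M) := ⟨⟨0, hM⟩⟩
  exists_eq_ciInf_of_finite

/-- Gaps of one arm differ by at most `2ε` between players, so one gap above `5ε` forces all of them
above `3ε`. -/
theorem lt_minGap {ε : ℝ} (hν : ν.IsDissimilar ε) (hM : 0 < M) {i : Fin K}
    (hi : i ∈ ν.subpar ε) : 3 * ε < ν.minGap i := by
  obtain ⟨p, hp⟩ : ∃ p : Fin M, 5 * ε < ν.gap p i := by simpa [subpar] using hi
  obtain ⟨q, hq⟩ := ν.exists_gap_eq_minGap hM i
  have := ν.gap_le_add hν p q i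
  linarith

theorem gap_le_two_mul_minGap {ε : ℝ} (hν : ν.IsDissimilar ε) (hM : 0 < M)
    (hε : 0 ≤ ε) {i : Fin K} (hi : i ∈ ν.subpar ε) (p : Fin M) :
    ν.gap p i ≤ 2 * ν.minGap i := by
  obtain ⟨q, hq⟩ := ν.exists_gap_eq_minGap hM i
  have := ν.gap_le_add hν p q i
  have := ν.lt_minGap hν hM hi
  linarith

/-! ### The exponential supermartingale. -/

/-- Sum of the centered rewards that the players in `S` collected from arm `i`. -/
noncomputable def deviation (S : Finset (Fin M)) (i : Fin K) (h : History M K n) : ℝ :=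
  ∑ p ∈ S, (h.rewardSum p i - h.pulls p i * ν.mean p i)

theorem measurable_deviation (S : Finset (Fin M)) (i : Fin K) :
    Measurable (ν.deviation S i : History M K n → ℝ) := by
  refine Finset.measurable_sum _ fun p _ => (measurable_rewardSum p i).sub ?_
  exact (measurable_from_nat.comp (measurable_pulls p i)).mul_const _

theorem deviation_appendRound (S : Finset (Fin M)) (i : Fin K) (h : History M K n)
    (a : Fin M → Fin K) (r : Fin M → ℝ) :
    ν.deviation S i (appendRound (h, a, r)) =
      ν.deviation S i h + ∑ p ∈ S, if a p = i then r p - ν.mean p i else 0 := by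
  simp only [deviation, pulls_appendRound, rewardSum_appendRound, ← Finset.sum_add_distrib]
  refine Finset.sum_congr rfl fun p _ => ?_
  split_ifs <;> push_cast <;> ring

theorem lintegral_law_succ (A : BanditAlgorithm M K) {f : History M K (n + 1) → ENNReal}
    (hf : Measurable f) :
    ∫⁻ h, f h ∂(ν.law A (n + 1)) =
      ∫⁻ h, ∫⁻ a, ∫⁻ r, f (appendRound (h, a, r)) ∂(ν.rewardKernel a) ∂(A.policy n h)
        ∂(ν.law A n) := by
  have hg := hf.comp (measurable_appendRound (M := M) (K := K) (n := n))
  rw [law, lintegral_map hf measurable_appendRound]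
  refine (Measure.lintegral_compProd hg).trans ?_
  refine lintegral_congr fun h => ?_
  exact Kernel.lintegral_compProd _ _ _ (hg.comp measurable_prodMk_left)

/-- One-step drift inequality, the induction step both for the supermartingale and for the excess
counts. -/
theorem lintegral_law_succ_le (A : BanditAlgorithm M K) {f : History M K (n + 1) → ENNReal}
    {g : History M K n → ENNReal} (hf : Measurable f)
    (hfg : ∀ h, ∀ᵐ a ∂(A.policy n h),
      ∫⁻ r, f (appendRound (h, a, r)) ∂(ν.rewardKernel a) ≤ g h) :
    ∫⁻ h, f h ∂(ν.law A (n + 1)) ≤ ∫⁻ h, g h ∂(ν.law A n) := by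
  rw [ν.lintegral_law_succ A hf]
  refine lintegral_mono fun h => ?_
  calc _ ≤ ∫⁻ _a, g h ∂(A.policy n h) := lintegral_mono_ae (hfg h)
    _ = g h := by simp

/-- Hoeffding's lemma for the rewards of an arm. -/
theorem integrable_exp_reward (p : Fin M) (i : Fin K) (l : ℝ) :
    Integrable (fun x => Real.exp (l * (x - ν.mean p i) - l ^ 2 / 8)) (ν.dist p i) ∧
      ∫ x, Real.exp (l * (x - ν.mean p i) - l ^ 2 / 8) ∂(ν.dist p i) ≤ 1 := by
  have h := hasSubgaussianMGF_of_mem_Icc (X := fun x : ℝ => x) (by fun_prop) (ν.ae_mem_Icc p i)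
  have h1 := h.integrable_exp_mul l
  have h2 := h.mgf_le l
  simp only [Real.exp_sub]
  refine ⟨h1.div_const _, ?_⟩
  rw [integral_div, div_le_one (Real.exp_pos _)]
  refine h2.trans (Real.exp_le_exp.2 (le_of_eq ?_))
  simp
  ring

/-- Rewards within a round are independent, so the integral factors over players; each factor is at
most 1 by Hoeffding's lemma, or equals 1 for a player who does not contribute. -/
theorem lintegral_exp_round_le (S : Finset (Fin M)) (i : Fin K) (a : Fin M → Fin K) (l : ℝ) :
    ∫⁻ r, ENNReal.ofReal (∏ p : Fin M, if p ∈ S ∧ a p = i then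
      Real.exp (l * (r p - ν.mean p i) - l ^ 2 / 8) else 1) ∂(ν.rewardKernel a) ≤ 1 := by
  let f : (p : Fin M) → ℝ → ℝ := fun p x => if p ∈ S ∧ a p = i then
    Real.exp (l * (x - ν.mean p i) - l ^ 2 / 8) else 1
  have hf0 : ∀ p x, 0 ≤ f p x := fun p x => by
    simp only [f]; split_ifs <;> positivity
  have hf : ∀ p, Integrable (f p) (ν.dist p (a p)) ∧ ∫ x, f p x ∂(ν.dist p (a p)) ≤ 1 := by
    intro p
    by_cases hp : p ∈ S ∧ a p = i
    · simp only [f, if_pos hp]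
      rw [hp.2]
      exact ν.integrable_exp_reward p i l
    · simp [f, if_neg hp]
  change ∫⁻ r, ENNReal.ofReal (∏ p, f p (r p)) ∂(Measure.pi fun p => ν.dist p (a p)) ≤ 1
  rw [← ofReal_integral_eq_lintegral_ofReal (Integrable.fintype_prod_dep fun p => (hf p).1)
    (ae_of_all _ fun r => Finset.prod_nonneg fun p _ => hf0 p _),
    integral_fintype_prod_eq_prod, ENNReal.ofReal_le_one]
  exact Finset.prod_le_one (fun p _ => integral_nonneg (hf0 p)) fun p _ => (hf p).2

/-- The exponential supermartingale of the deviations has expectation at most `1`. -/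
theorem lintegral_exp_deviation_le (A : BanditAlgorithm M K) (S : Finset (Fin M)) (i : Fin K)
    (l : ℝ) (n : ℕ) :
    ∫⁻ h, ENNReal.ofReal (Real.exp (l * ν.deviation S i h - l ^ 2 / 8 * count S i h))
      ∂(ν.law A n) ≤ 1 := by
  have hmeas : ∀ n, Measurable fun h : History M K n =>
      ENNReal.ofReal (Real.exp (l * ν.deviation S i h - l ^ 2 / 8 * count S i h)) := fun n => by
    have h1 := ν.measurable_deviation (n := n) S i
    have h2 : Measurable fun h : History M K n => (count S i h : ℝ) :=
      measurable_from_nat.comp (measurable_count S i)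
    fun_prop
  induction n with
  | zero => simp [law, deviation, count, pulls_eq_sum,
      rewardSum_eq_sum]
  | succ n ih =>
    refine (ν.lintegral_law_succ_le A (hmeas (n + 1)) fun h => ae_of_all _ fun a => ?_).trans ih
    have hkey : ∀ r : Fin M → ℝ,
        ENNReal.ofReal (Real.exp (l * ν.deviation S i (appendRound (h, a, r)) -
          l ^ 2 / 8 * count S i (appendRound (h, a, r)))) =
        ENNReal.ofReal (Real.exp (l * ν.deviation S i h - l ^ 2 / 8 * count S i h)) *
          ENNReal.ofReal (∏ p : Fin M, if p ∈ S ∧ a p = i then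
            Real.exp (l * (r p - ν.mean p i) - l ^ 2 / 8) else 1) := by
      intro r
      have hprod : (∏ p : Fin M, if p ∈ S ∧ a p = i then
          Real.exp (l * (r p - ν.mean p i) - l ^ 2 / 8) else 1) =
          Real.exp (∑ p ∈ S, if a p = i then l * (r p - ν.mean p i) - l ^ 2 / 8 else 0) := by
        rw [Real.exp_sum, ← Finset.prod_subset (Finset.subset_univ S)]
        · refine Finset.prod_congr rfl fun p hp => ?_
          by_cases h : a p = i <;> simp [hp, h]
        · intro p _ hp
          simp [hp]
      rw [hprod, ← ENNReal.ofReal_mul (Real.exp_nonneg _), ← Real.exp_add,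
        deviation_appendRound, count_appendRound]
      congr 2
      push_cast
      rw [mul_add, mul_add, add_sub_add_comm, Finset.mul_sum, Finset.mul_sum,
        ← Finset.sum_sub_distrib]
      congr 1
      refine Finset.sum_congr rfl fun p _ => ?_
      split_ifs <;> ring
    simp only [hkey]
    rw [lintegral_const_mul' _ _ ENNReal.ofReal_ne_top]
    exact mul_le_of_le_one_right' (ν.lintegral_exp_round_le S i a l)

end MPMAB

/-! ### Concentration and the probability of bad histories. -/

namespace MPMAB

variable {M K n : ℕ} (ν : MPMAB M K)

open History

/-- The deviation of the rewards that the players in `S` collected from arm `i` is within the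
confidence bound for horizon `T`. -/
def Concentrated (T : ℕ) (S : Finset (Fin M)) (i : Fin K) (h : History M K n) : Prop :=
  |ν.deviation S i h| ≤ 2 * √(Real.log T * count S i h)

/-- All own and aggregate deviations are within their confidence bounds. -/
def Good (T : ℕ) (h : History M K n) : Prop :=
  ∀ i p, ν.Concentrated T {p} i h ∧ ν.Concentrated T {p}ᶜ i h

theorem measurableSet_concentrated (T : ℕ) (S : Finset (Fin M)) (i : Fin K) :
    MeasurableSet {h : History M K n | ν.Concentrated T S i h} := by
  have h1 := ν.measurable_deviation (n := n) S i
  have h2 : Measurable fun h : History M K n => (count S i h : ℝ) :=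
    measurable_from_nat.comp (measurable_count S i)
  exact measurableSet_le (by fun_prop) (by fun_prop)

theorem measurableSet_good (T : ℕ) : MeasurableSet {h : History M K n | ν.Good T h} := by
  simp only [Good, Set.ofPred_forall, Set.ofPred_and]
  exact MeasurableSet.iInter fun i => MeasurableSet.iInter fun p =>
    (ν.measurableSet_concentrated T _ i).inter (ν.measurableSet_concentrated T _ i)

/-- Fixing the count at `m` makes the compensator `l ^ 2 / 8 * m` deterministic, so Markov's
inequality applies. The sign `s = ±1` selects the tail. -/
theorem law_le_deviation_le (A : BanditAlgorithm M K) (S : Finset (Fin M)) (i : Fin K) {L : ℝ}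
    (hL : 0 ≤ L) {m : ℕ} (hm : 0 < m) {s : ℝ} (hs : s ^ 2 = 1) (n : ℕ) :
    ν.law A n {h | count S i h = m ∧ 2 * √(L * m) ≤ s * ν.deviation S i h} ≤
      ENNReal.ofReal (Real.exp (-(8 * L))) := by
  have hm' : (0 : ℝ) < m := by exact_mod_cast hm
  set y := 2 * √(L * m) with hy
  have hy0 : 0 ≤ y := by positivity
  have hy2 : y ^ 2 = 4 * (L * m) := by
    rw [hy, mul_pow, Real.sq_sqrt (by positivity)]; ring
  -- Up to the sign `s`, this maximizes `l * y - l ^ 2 * m / 8`; the maximum is `2 * y ^ 2 / m = 8 *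
  -- L`.
  set l := s * (4 * y / m) with hl
  have hmeas : Measurable fun h : History M K n =>
      ENNReal.ofReal (Real.exp (l * ν.deviation S i h - l ^ 2 / 8 * count S i h)) := by
    have h1 := ν.measurable_deviation (n := n) S i
    have h2 : Measurable fun h : History M K n => (count S i h : ℝ) :=
      measurable_from_nat.comp (measurable_count S i)
    fun_prop
  have hmarkov := (mul_meas_ge_le_lintegral (μ := ν.law A n) hmeas
    (ENNReal.ofReal (Real.exp (8 * L)))).trans (ν.lintegral_exp_deviation_le A S i l n)
  rw [Real.exp_neg, ENNReal.ofReal_inv_of_pos (Real.exp_pos _), ENNReal.le_inv_iff_mul_le, mul_comm]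
  refine le_trans (mul_le_mul_right (measure_mono ?_) _) hmarkov
  rintro h ⟨hc, hd⟩
  refine ENNReal.ofReal_le_ofReal (Real.exp_le_exp.2 ?_)
  rw [hc]
  have e1 : l * ν.deviation S i h = 4 * y / m * (s * ν.deviation S i h) := by rw [hl]; ring
  have e2 : l ^ 2 / 8 * m = 8 * L := by
    rw [hl, mul_pow, hs, div_pow, mul_pow, hy2]; field_simp; ring
  have e3 : 4 * y / m * y = 16 * L := by
    rw [show 4 * y / m * y = 4 * y ^ 2 / m by ring, hy2]; field_simp; ring
  have e4 : 4 * y / m * y ≤ 4 * y / m * (s * ν.deviation S i h) :=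
    mul_le_mul_of_nonneg_left hd (by positivity)
  rw [e1, e2]
  linarith

theorem law_not_concentrated_le (A : BanditAlgorithm M K) {T : ℕ} (hT : M ≤ T) (S : Finset (Fin M))
    (i : Fin K) (hn : n ≤ T) :
    ν.law A n {h | ¬ ν.Concentrated T S i h} ≤
      ENNReal.ofReal (2 * T ^ 2 * Real.exp (-(8 * Real.log T))) := by
  have hL := Real.log_natCast_nonneg T
  set e := ENNReal.ofReal (Real.exp (-(8 * Real.log T))) with he
  let B : ℝ → ℕ → Set (History M K n) := fun s m =>
    {h | count S i h = m ∧ 2 * √(Real.log T * m) ≤ s * ν.deviation S i h}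
  have hsub : {h | ¬ ν.Concentrated T S i h} ⊆
      ⋃ m ∈ Finset.Icc 1 (T ^ 2), (B 1 m ∪ B (-1) m) := by
    intro h hh
    have hh : 2 * √(Real.log T * count S i h) < |ν.deviation S i h| := not_le.1 hh
    simp only [Set.mem_iUnion, Finset.mem_Icc]
    refine ⟨count S i h, ⟨?_, ?_⟩, ?_⟩
    -- With no pulls the deviation is 0, so failure needs a positive count.
    · by_contra hc
      have hc : ∀ p ∈ S, h.pulls p i = 0 := by
        simpa [count] using Nat.lt_one_iff.1 (not_le.1 hc)
      have hd : ν.deviation S i h = 0 := by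
        refine Finset.sum_eq_zero fun p hp => ?_
        have hp := hc p hp
        rw [rewardSum, hp]
        rw [pulls, Finset.card_eq_zero] at hp
        simp [hp]
      rw [hd, abs_zero] at hh
      exact absurd hh (not_lt.2 (by positivity))
    · exact (count_le S i h).trans (by rw [sq]; exact Nat.mul_le_mul hT hn)
    · rcases lt_abs.1 hh with h1 | h1
      · exact Or.inl ⟨rfl, by linarith⟩
      · exact Or.inr ⟨rfl, by linarith⟩
  calc _ ≤ ∑ m ∈ Finset.Icc 1 (T ^ 2), ν.law A n (B 1 m ∪ B (-1) m) :=
        (measure_mono hsub).trans (measure_biUnion_finset_le _ _)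
    _ ≤ ∑ m ∈ Finset.Icc 1 (T ^ 2), (e + e) := by
        refine Finset.sum_le_sum fun m hm => (measure_union_le _ _).trans ?_
        have hm := (Finset.mem_Icc.1 hm).1
        exact add_le_add (ν.law_le_deviation_le A S i hL hm (by norm_num) n)
          (ν.law_le_deviation_le A S i hL hm (by norm_num) n)
    _ = ENNReal.ofReal (2 * T ^ 2 * Real.exp (-(8 * Real.log T))) := by
        rw [ENNReal.ofReal_mul (by positivity), ← he, ENNReal.ofReal_mul (by positivity)]
        simp [← two_mul]
        ring

theorem law_not_good_le (A : BanditAlgorithm M K) {T : ℕ} (hT : max M K < T) (hM : 0 < M)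
    (hn : n ≤ T) : ν.law A n {h | ¬ ν.Good T h} ≤ ENNReal.ofReal (1 / T) := by
  obtain ⟨hMT, hKT⟩ := max_lt_iff.1 hT
  have hT2 : (2 : ℝ) ≤ T := by exact_mod_cast (show 2 ≤ T by omega)
  have hMT' : (M : ℝ) ≤ T := by exact_mod_cast hMT.le
  have hKT' : (K : ℝ) ≤ T := by exact_mod_cast hKT.le
  set b := 2 * (T : ℝ) ^ 2 * Real.exp (-(8 * Real.log T)) with hb
  have hb0 : 0 ≤ b := by positivity
  have hsub : {h : History M K n | ¬ ν.Good T h} ⊆ ⋃ i, ⋃ p,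
      ({h | ¬ ν.Concentrated T {p} i h} ∪ {h | ¬ ν.Concentrated T {p}ᶜ i h}) := by
    intro h hh
    simp only [Set.mem_ofPred_eq, Good, not_forall, not_and_or] at hh
    obtain ⟨i, p, hh⟩ := hh
    exact Set.mem_iUnion.2 ⟨i, Set.mem_iUnion.2 ⟨p, hh⟩⟩
  calc _ ≤ ∑ _i : Fin K, ∑ _p : Fin M, (ENNReal.ofReal b + ENNReal.ofReal b) := by
        refine (measure_mono hsub).trans ((measure_iUnion_fintype_le _ _).trans ?_)
        refine Finset.sum_le_sum fun i _ => (measure_iUnion_fintype_le _ _).trans ?_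
        refine Finset.sum_le_sum fun p _ => (measure_union_le _ _).trans ?_
        exact add_le_add (ν.law_not_concentrated_le A hMT.le _ i hn)
          (ν.law_not_concentrated_le A hMT.le _ i hn)
    _ = ENNReal.ofReal (K * (M * (b + b))) := by
        rw [ENNReal.ofReal_mul (Nat.cast_nonneg K), ENNReal.ofReal_mul (Nat.cast_nonneg M),
          ENNReal.ofReal_add hb0 hb0]
        simp [mul_add]
    -- Each event costs `2 * T ^ (-6)` and there are at most `2 * T ^ 2` of them; `4 / T ^ 4 ≤ 1 /
    -- T` because `T ≥ 2`.
    _ ≤ ENNReal.ofReal (1 / T) := by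
        refine ENNReal.ofReal_le_ofReal ?_
        have he : Real.exp (-(8 * Real.log T)) = 1 / (T : ℝ) ^ 8 := by
          rw [Real.exp_neg, show 8 * Real.log T = Real.log ((T : ℝ) ^ 8) by
            rw [Real.log_pow]; norm_num, Real.exp_log (by positivity), one_div]
        calc (K * (M * (b + b)) : ℝ) ≤ T * (T * (b + b)) := by gcongr
          _ = 4 / (T : ℝ) ^ 4 := by rw [hb, he]; field_simp; ring
          _ ≤ 1 / T := by
            rw [div_le_div_iff₀ (by positivity) (by positivity)]
            nlinarith [pow_le_pow_left₀ (by norm_num) hT2 3]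

/-! ### From thresholds on good histories to expected counts. -/

/-- Beyond the threshold `B`, arm `i` is pulled by the players in `S` only on bad histories. -/
theorem lintegral_count_sub_le (A : BanditAlgorithm M K) {T : ℕ} {ε : ℝ}
    (hA : A.IsRobustAgg T ε) (S : Finset (Fin M)) (i : Fin K) (B : ℕ)
    (hB : ∀ k < T, ∀ h : History M K k, ν.Good T h → ∀ p ∈ S,
      (∀ j, RobustAgg.ucb T ε h p j ≤ RobustAgg.ucb T ε h p i) → count S i h ≤ B)
    (hn : n ≤ T) :
    ∫⁻ h, ((count S i h - (B + S.card) : ℕ) : ENNReal) ∂(ν.law A n) ≤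
      S.card * ∑ k ∈ Finset.range n, ν.law A k {h | ¬ ν.Good T h} := by
  have hmeas : ∀ n, Measurable fun h : History M K n =>
      ((count S i h - (B + S.card) : ℕ) : ENNReal) := fun n =>
    (measurable_from_nat (f := fun c => ((c - (B + S.card) : ℕ) : ENNReal))).comp
      (measurable_count S i)
  induction n with
  | zero => simp [law, count, pulls_eq_sum]
  | succ n ih =>
    have hbad : MeasurableSet {h : History M K n | ¬ ν.Good T h} := (ν.measurableSet_good T).compl
    calc _ ≤ ∫⁻ h, ((count S i h - (B + S.card) : ℕ) : ENNReal) +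
          {h : History M K n | ¬ ν.Good T h}.indicator (fun _ => (S.card : ENNReal)) h
          ∂(ν.law A n) := by
          refine ν.lintegral_law_succ_le A (hmeas (n + 1)) fun h => ?_
          filter_upwards [hA n hn h] with a ha
          have hconst : ∀ c : ENNReal, ∫⁻ _r, c ∂(ν.rewardKernel a) = c := fun c => by simp
          simp only [count_appendRound]
          rw [hconst]
          have hcard : (∑ p ∈ S, if a p = i then 1 else 0) ≤ S.card := by
            simpa using Finset.card_filter_le S fun p => a p = i
          by_cases hg : ν.Good T h
          · rw [Set.indicator_of_notMem (by simpa using hg), add_zero, Nat.cast_le]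
            by_cases hp : ∃ p ∈ S, a p = i
            -- Before this round the count is at most `B`, and the round adds at most `S.card`, so
            -- the truncated excess is still 0.
            · obtain ⟨p, hp, rfl⟩ := hp
              have := hB n hn h hg p hp (ha p)
              omega
            · push Not at hp
              rw [Finset.sum_eq_zero fun p hpS => if_neg (hp p hpS), add_zero]
          · rw [Set.indicator_of_mem (by simpa using hg), ← Nat.cast_add, Nat.cast_le]
            omega
      _ ≤ _ := by
          rw [lintegral_add_left (hmeas n), lintegral_indicator_const hbad, Finset.sum_range_succ,
            mul_add]
          gcongr
          exact ih (Nat.le_of_succ_le hn)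

/-- One `S.card` is the overshoot in the round that crosses `B`; the other pays for bad histories,
whose probabilities over the `T` rounds sum to at most 1. -/
theorem integral_count_le (A : BanditAlgorithm M K) {T : ℕ} (hT : max M K < T) (hM : 0 < M) {ε : ℝ}
    (hA : A.IsRobustAgg T ε) (S : Finset (Fin M)) (i : Fin K) {B : ℝ} (hB0 : 0 ≤ B)
    (hB : ∀ k < T, ∀ h : History M K k, ν.Good T h → ∀ p ∈ S,
      (∀ j, RobustAgg.ucb T ε h p j ≤ RobustAgg.ucb T ε h p i) → (count S i h : ℝ) ≤ B) :
    ∫ h, (count S i h : ℝ) ∂(ν.law A T) ≤ B + 2 * S.card := by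
  have hT0 : 0 < T := by omega
  have hsum : ∑ k ∈ Finset.range T, ν.law A k {h | ¬ ν.Good T h} ≤ 1 := by
    calc _ ≤ ∑ _k ∈ Finset.range T, ENNReal.ofReal (1 / T) := Finset.sum_le_sum fun k hk =>
          ν.law_not_good_le A hT hM (Finset.mem_range.1 hk).le
      _ = ENNReal.ofReal (T * (1 / T)) := by
          rw [ENNReal.ofReal_mul (by positivity)]; simp
      _ = 1 := by rw [mul_one_div_cancel (by positivity), ENNReal.ofReal_one]
  have hfl : ∀ k < T, ∀ h : History M K k, ν.Good T h → ∀ p ∈ S,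
      (∀ j, RobustAgg.ucb T ε h p j ≤ RobustAgg.ucb T ε h p i) → count S i h ≤ ⌊B⌋₊ :=
    fun k hk h hg p hp hu => Nat.le_floor (hB k hk h hg p hp hu)
  have hmain : ∫⁻ h, (count S i h : ENNReal) ∂(ν.law A T) ≤
      ((⌊B⌋₊ + S.card : ℕ) : ENNReal) + S.card := by
    calc _ ≤ ∫⁻ h, (((⌊B⌋₊ + S.card : ℕ) : ENNReal) +
          ((count S i h - (⌊B⌋₊ + S.card) : ℕ) : ENNReal)) ∂(ν.law A T) := by
          refine lintegral_mono fun h => ?_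
          rw [← Nat.cast_add, Nat.cast_le]
          omega
      _ ≤ _ := by
          rw [lintegral_add_left measurable_const, lintegral_const, measure_univ, mul_one]
          gcongr
          refine (ν.lintegral_count_sub_le A hA S i _ hfl le_rfl).trans ?_
          exact mul_le_of_le_one_right' hsum
  have hmeas : Measurable fun h : History M K T => (count S i h : ℝ) :=
    measurable_from_nat.comp (measurable_count S i)
  rw [integral_eq_lintegral_of_nonneg_ae (ae_of_all _ fun h => Nat.cast_nonneg _)
    hmeas.aestronglyMeasurable]
  simp only [ENNReal.ofReal_natCast]
  refine ENNReal.toReal_le_of_le_ofReal (by positivity) (hmain.trans ?_)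
  rw [← Nat.cast_add, ← ENNReal.ofReal_natCast]
  refine ENNReal.ofReal_le_ofReal ?_
  push_cast
  linarith [Nat.floor_le hB0]

end MPMAB

/-! ### The confidence width. -/

namespace RobustAgg

/-- The left side is the deviation plus bias of the mixed estimate. With `u = l / √n` and `v = (1 -
l) / √m` it reduces to `(u + v) ^ 2 ≤ 2 * (u ^ 2 + v ^ 2)`, with room to spare in the constants. -/
theorem add_le_width {T n m : ℕ} {l ε : ℝ} :
    l * (2 * √(Real.log T) / √n) + (1 - l) * (2 * √(Real.log T) / √m + ε) ≤ width T n m l ε := by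
  have hL := Real.log_natCast_nonneg T
  have hu : l ^ 2 / n = (l / √n) ^ 2 := by rw [div_pow, Real.sq_sqrt (Nat.cast_nonneg n)]
  have hv : (1 - l) ^ 2 / m = ((1 - l) / √m) ^ 2 := by
    rw [div_pow, Real.sq_sqrt (Nat.cast_nonneg m)]
  rw [width, hu, hv]
  set u := l / √n with hu'
  set v := (1 - l) / √m with hv'
  have h : √(Real.log T) * (u + v) / 4 ≤ √(13 * Real.log T * (u ^ 2 + v ^ 2)) := by
    refine Real.le_sqrt_of_sq_le ?_
    rw [div_pow, mul_pow, Real.sq_sqrt hL]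
    nlinarith [mul_nonneg hL (sq_nonneg (u - v)), mul_nonneg hL (sq_nonneg (u + v)),
      mul_nonneg hL (sq_nonneg u), mul_nonneg hL (sq_nonneg v)]
  have e : l * (2 * √(Real.log T) / √n) + (1 - l) * (2 * √(Real.log T) / √m + ε) =
      8 * (√(Real.log T) * (u + v) / 4) + (1 - l) * ε := by rw [hu', hv']; ring
  rw [e]
  linarith

theorem width_one (T n m : ℕ) (ε : ℝ) : width T n m 1 ε = 8 * √(13 * Real.log T / n) := by
  simp [width, div_eq_mul_inv]

/-- Weighting by sample sizes turns `λ² / n + (1 - λ)² / m` into `1 / (n + m)`. -/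
theorem width_pooled_le {T n m : ℕ} (hn : 0 < n) {ε : ℝ} (hε : 0 ≤ ε) :
    width T n m (n / (n + m)) ε ≤ 8 * √(13 * Real.log T / (n + m)) + ε := by
  have hn' : (0 : ℝ) < n := by exact_mod_cast hn
  have e : (1 - n / (n + m) : ℝ) = m / (n + m) := by field_simp; ring
  rw [width, e]
  refine add_le_add (le_of_eq ?_) (mul_le_of_le_one_left hε ?_)
  · congr 2
    rcases Nat.eq_zero_or_pos m with rfl | hm
    · field_simp
    · have hm' : (0 : ℝ) < m := by exact_mod_cast hm
      field_simp
  · rw [div_le_one (by positivity)]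
    linarith

end RobustAgg

/-! ### Pull bounds on good histories. -/

namespace MPMAB

variable {M K n : ℕ} (ν : MPMAB M K)

open History

/-- The error splits into the deviation and a count-weighted average of the biases `mean q i - c`.
It serves `ζ` (`S = {p}`, no bias) and `η` (`S = {p}ᶜ`, bias at most `ε`). -/
theorem abs_pooledMean_sub_le {T : ℕ} (hT : 2 ≤ T) {S : Finset (Fin M)} {i : Fin K}
    {h : History M K n} (hS : ν.Concentrated T S i h) {c ε : ℝ} (hc : c ∈ Set.Icc (0 : ℝ) 1)
    (hε : 0 ≤ ε) (hcε : ∀ q ∈ S, |ν.mean q i - c| ≤ ε) :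
    |1 / ((max 1 (count S i h) : ℕ) : ℝ) * ∑ q ∈ S, h.rewardSum q i - c| ≤
      2 * √(Real.log T) / √((max 1 (count S i h) : ℕ) : ℝ) + ε := by
  -- Without data the estimate is 0, and the error `c ≤ 1` is covered by `2 * √(Real.log T)` since
  -- `Real.log 2 ≥ 1 / 4`.
  rcases Nat.eq_zero_or_pos (count S i h) with h0 | hpos
  · have hc0 : ∀ q ∈ S, h.pulls q i = 0 := by simpa [count] using h0
    have hR : ∑ q ∈ S, h.rewardSum q i = 0 := by
      refine Finset.sum_eq_zero fun q hq => ?_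
      have hq := hc0 q hq
      rw [pulls, Finset.card_eq_zero] at hq
      simp [rewardSum, hq]
    have hlog : 1 / 2 ≤ √(Real.log T) := by
      refine Real.le_sqrt_of_sq_le ?_
      have h2 : Real.log 2 ≤ Real.log T :=
        Real.log_le_log (by norm_num) (by exact_mod_cast hT)
      linarith [Real.log_two_gt_d9]
    rw [hR, h0]
    simp only [mul_zero, zero_sub, abs_neg, abs_of_nonneg hc.1]
    simp
    linarith [hc.2]
  · rw [max_eq_right hpos]
    set N := count S i h with hN
    have hN' : (0 : ℝ) < N := by exact_mod_cast hpos
    have hdec : ∑ q ∈ S, h.rewardSum q i - N * c =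
        ν.deviation S i h + ∑ q ∈ S, h.pulls q i * (ν.mean q i - c) := by
      rw [hN, count, deviation]
      push_cast
      rw [Finset.sum_mul, ← Finset.sum_sub_distrib, ← Finset.sum_add_distrib]
      exact Finset.sum_congr rfl fun q _ => by ring
    have hbias : |∑ q ∈ S, h.pulls q i * (ν.mean q i - c)| ≤ N * ε := by
      refine (Finset.abs_sum_le_sum_abs _ _).trans ?_
      rw [hN, count]
      push_cast
      rw [Finset.sum_mul]
      refine Finset.sum_le_sum fun q hq => ?_
      rw [abs_mul, Nat.abs_cast]
      exact mul_le_mul_of_nonneg_left (hcε q hq) (Nat.cast_nonneg _)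
    have hdev : |ν.deviation S i h| ≤ N * (2 * √(Real.log T) / √N) := by
      refine hS.trans (le_of_eq ?_)
      rw [Real.sqrt_mul (Real.log_natCast_nonneg T), ← hN]
      have : (N : ℝ) = √N * √N := (Real.mul_self_sqrt hN'.le).symm
      have hs : √(N : ℝ) ≠ 0 := (Real.sqrt_pos.2 hN').ne'
      rw [mul_div_assoc', eq_div_iff hs]
      nth_rewrite 3 [this]
      ring
    have e : 1 / (N : ℝ) * ∑ q ∈ S, h.rewardSum q i - c =
        (∑ q ∈ S, h.rewardSum q i - N * c) / N := by field_simp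
    rw [e, hdec, abs_div, abs_of_pos hN', div_le_iff₀ hN']
    refine (abs_add_le _ _).trans ?_
    linarith

theorem count_singleton (p : Fin M) (i : Fin K) (h : History M K n) :
    count {p} i h = h.pulls p i := by simp [count]

theorem count_compl_singleton (p : Fin M) (i : Fin K) (h : History M K n) :
    count {p}ᶜ i h = h.otherPulls p i := by
  rw [count, otherPulls]
  congr 1
  ext q
  simp

theorem count_univ (p : Fin M) (i : Fin K) (h : History M K n) :
    count Finset.univ i h = h.pulls p i + h.otherPulls p i := by
  rw [← count_compl_singleton, count, count, Finset.compl_eq_univ_sdiff,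
    ← Finset.sum_sdiff (Finset.subset_univ {p}),
    Finset.sum_singleton, add_comm]

theorem abs_mixMean_sub_mean_le {T : ℕ} (hT : 2 ≤ T) {ε : ℝ} (hε : 0 ≤ ε)
    (hν : ν.IsDissimilar ε) {h : History M K n} (hg : ν.Good T h) (p : Fin M) (i : Fin K)
    {l : ℝ} (hl : l ∈ Set.Icc (0 : ℝ) 1) :
    |h.mixMean p i l - ν.mean p i| ≤
      RobustAgg.width T (max 1 (h.pulls p i)) (max 1 (h.otherPulls p i)) l ε := by
  have h1 := ν.abs_pooledMean_sub_le hT (hg i p).1 (ν.mean_mem_Icc p i) le_rfl (by simp)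
  have h2 := ν.abs_pooledMean_sub_le hT (hg i p).2 (ν.mean_mem_Icc p i) hε
    fun q _ => hν q p i
  rw [count_singleton, Finset.sum_singleton, add_zero] at h1
  rw [count_compl_singleton] at h2
  change |h.ownMean p i - ν.mean p i| ≤ _ at h1
  have hS : ({p}ᶜ : Finset (Fin M)) = Finset.univ.filter fun q => q ≠ p := by ext q; simp
  rw [hS] at h2
  change |h.otherMean p i - ν.mean p i| ≤ _ at h2
  refine le_trans ?_ RobustAgg.add_le_width
  have e : h.mixMean p i l - ν.mean p i =
      l * (h.ownMean p i - ν.mean p i) + (1 - l) * (h.otherMean p i - ν.mean p i) := by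
    rw [mixMean]; ring
  have hl1 : 0 ≤ 1 - l := sub_nonneg.2 hl.2
  rw [e]
  refine (abs_add_le _ _).trans ?_
  rw [abs_mul, abs_mul, abs_of_nonneg hl.1, abs_of_nonneg hl1]
  exact add_le_add (mul_le_mul_of_nonneg_left h1 hl.1) (mul_le_mul_of_nonneg_left h2 hl1)

/-- On a good history, an arm of maximal upper confidence bound has a gap of at most twice every
confidence width. -/
theorem gap_le_two_mul_width {T : ℕ} (hT : 2 ≤ T) {ε : ℝ} (hε : 0 ≤ ε)
    (hν : ν.IsDissimilar ε) {h : History M K n} (hg : ν.Good T h) {p : Fin M} {i : Fin K}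
    (hi : ∀ j, RobustAgg.ucb T ε h p j ≤ RobustAgg.ucb T ε h p i)
    {l : ℝ} (hl : l ∈ Set.Icc (0 : ℝ) 1) :
    ν.gap p i ≤
      2 * RobustAgg.width T (max 1 (h.pulls p i)) (max 1 (h.otherPulls p i)) l ε := by
  obtain ⟨j, hj⟩ := ν.exists_mean_eq_bestMean i.pos p
  have hopt : ∀ k, RobustAgg.optWeight T (max 1 (h.pulls p k)) (max 1 (h.otherPulls p k)) ε ∈
      Set.Icc (0 : ℝ) 1 ∧ IsMinOn (fun l => RobustAgg.width T (max 1 (h.pulls p k))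
        (max 1 (h.otherPulls p k)) l ε) (Set.Icc 0 1)
        (RobustAgg.optWeight T (max 1 (h.pulls p k)) (max 1 (h.otherPulls p k)) ε) := fun k =>
    (RobustAgg.exists_isMinOn_width T (max 1 (h.pulls p k)) (max 1 (h.otherPulls p k))
      ε).choose_spec
  -- For an optimal arm `j`: `μ_j ≤ UCB_j ≤ UCB_i ≤ μ_i + 2 F(λ*) ≤ μ_i + 2 F(l)`.
  have hij := hi j
  simp only [RobustAgg.ucb] at hij
  have h1 := (abs_le.1 (ν.abs_mixMean_sub_mean_le hT hε hν hg p j (hopt j).1)).1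
  have h2 := (abs_le.1 (ν.abs_mixMean_sub_mean_le hT hε hν hg p i (hopt i).1)).2
  have h3 := (hopt i).2 hl
  simp only [Set.mem_ofPred_eq] at h3
  rw [gap, ← hj]
  linarith

theorem mul_sq_le_of_le_mul_sqrt {N x g c : ℝ} (hN : 0 < N) (hx : 0 ≤ x) (hg : 0 ≤ g)
    (h : g ≤ c * √(x / N)) : N * g ^ 2 ≤ c ^ 2 * x := by
  have h2 : g ^ 2 ≤ (c * √(x / N)) ^ 2 := pow_le_pow_left₀ hg h 2
  rw [mul_pow, Real.sq_sqrt (by positivity)] at h2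
  calc N * g ^ 2 ≤ N * (c ^ 2 * (x / N)) := mul_le_mul_of_nonneg_left h2 hN.le
    _ = c ^ 2 * x := by field_simp

theorem pulls_mul_gap_sq_le {T : ℕ} (hT : 2 ≤ T) {ε : ℝ} (hε : 0 ≤ ε)
    (hν : ν.IsDissimilar ε) {h : History M K n} (hg : ν.Good T h) {p : Fin M} {i : Fin K}
    (hi : ∀ j, RobustAgg.ucb T ε h p j ≤ RobustAgg.ucb T ε h p i) :
    h.pulls p i * ν.gap p i ^ 2 ≤ 3328 * Real.log T := by
  have hL := Real.log_natCast_nonneg T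
  have h1 := ν.gap_le_two_mul_width hT hε hν hg hi (l := 1) (by simp)
  rw [RobustAgg.width_one, ← mul_assoc] at h1
  have h2 := mul_sq_le_of_le_mul_sqrt (by positivity) (by positivity) (ν.gap_nonneg p i) h1
  have h3 : (h.pulls p i : ℝ) ≤ (max 1 (h.pulls p i) : ℕ) := by
    exact_mod_cast le_max_right _ _
  nlinarith [mul_le_mul_of_nonneg_right h3 (sq_nonneg (ν.gap p i))]

theorem count_univ_mul_gap_sq_le {T : ℕ} (hT : 2 ≤ T) {ε : ℝ} (hε : 0 ≤ ε)
    (hν : ν.IsDissimilar ε) {h : History M K n} (hg : ν.Good T h) {p : Fin M} {i : Fin K}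
    (hi : ∀ j, RobustAgg.ucb T ε h p j ≤ RobustAgg.ucb T ε h p i) (hgap : 3 * ε < ν.gap p i) :
    count Finset.univ i h * ν.gap p i ^ 2 ≤ 29952 * Real.log T := by
  have hL := Real.log_natCast_nonneg T
  set N := max 1 (h.pulls p i) with hN
  set m := max 1 (h.otherPulls p i) with hm
  have hN0 : 0 < N := lt_of_lt_of_le one_pos (le_max_left _ _)
  have hN0' : (0 : ℝ) < N := by exact_mod_cast hN0
  have h1 := ν.gap_le_two_mul_width hT hε hν hg hi (l := N / (N + m))
    ⟨by positivity, (div_le_one (by positivity)).2 (by simp)⟩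
  -- The bias term `2 * ε` is below two thirds of the gap, so the gap is at most three times `16 *
  -- √(..)`.
  have h2 : ν.gap p i ≤ 48 * √(13 * Real.log T / (N + m)) := by
    have := RobustAgg.width_pooled_le (T := T) (m := m) hN0 hε
    linarith
  have h3 := mul_sq_le_of_le_mul_sqrt (by positivity) (by positivity) (ν.gap_nonneg p i) h2
  have h4 : (count Finset.univ i h : ℝ) ≤ N + m := by
    rw [count_univ p]
    exact_mod_cast add_le_add (le_max_right _ _) (le_max_right _ _)
  nlinarith [mul_le_mul_of_nonneg_right h4 (sq_nonneg (ν.gap p i))]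

/-! ### Regret of a single arm. -/

theorem integrable_pulls (A : BanditAlgorithm M K) (p : Fin M) (i : Fin K) :
    Integrable (fun h : History M K n => (h.pulls p i : ℝ)) (ν.law A n) :=
  Integrable.of_mem_Icc 0 n (measurable_from_nat.comp (measurable_pulls p i)).aemeasurable
    (ae_of_all _ fun h => ⟨Nat.cast_nonneg _, by exact_mod_cast h.pulls_le p i⟩)

theorem gap_mul_integral_pulls_le (A : BanditAlgorithm M K) {T : ℕ} (hT : max M K < T)
    (hM : 0 < M) {ε : ℝ} (hε : 0 ≤ ε) (hν : ν.IsDissimilar ε) (hA : A.IsRobustAgg T ε)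
    {p : Fin M} {i : Fin K} (hgap : 0 < ν.gap p i) :
    ν.gap p i * ∫ h, (h.pulls p i : ℝ) ∂(ν.law A T) ≤ 3332 * (Real.log T / ν.gap p i) := by
  have hT2 : 2 ≤ T := by omega
  have hlog : 1 / 2 ≤ Real.log T := by
    have h2 : Real.log 2 ≤ Real.log T := Real.log_le_log (by norm_num) (by exact_mod_cast hT2)
    linarith [Real.log_two_gt_d9]
  have h1 := ν.integral_count_le A hT hM hA {p} i (B := 3328 * Real.log T / ν.gap p i ^ 2)
    (by positivity) fun k _ h hg q hq hu => by
      rw [Finset.mem_singleton.1 hq] at hu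
      rw [le_div_iff₀ (by positivity), count_singleton]
      exact ν.pulls_mul_gap_sq_le hT2 hε hν hg hu
  simp only [count_singleton, Finset.card_singleton] at h1
  -- The additive term is absorbed because the gap is at most 1 and `Real.log T ≥ 1 / 2`.
  have h2 : ν.gap p i ≤ 2 * (Real.log T / ν.gap p i) := by
    rw [mul_div_assoc', le_div_iff₀ hgap]
    nlinarith [ν.gap_le_one p i]
  calc _ ≤ ν.gap p i * (3328 * Real.log T / ν.gap p i ^ 2 + 2 * (1 : ℕ)) :=
        mul_le_mul_of_nonneg_left h1 hgap.le
    _ = 3328 * (Real.log T / ν.gap p i) + 2 * ν.gap p i := by push_cast; field_simp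
    _ ≤ _ := by linarith

theorem sum_gap_mul_integral_pulls_le (A : BanditAlgorithm M K) {T : ℕ} (hT : max M K < T)
    (hM : 0 < M) {ε : ℝ} (hε : 0 ≤ ε) (hν : ν.IsDissimilar ε) (hA : A.IsRobustAgg T ε)
    {i : Fin K} (hi : i ∈ ν.subpar ε) :
    ∑ p, ν.gap p i * ∫ h, (h.pulls p i : ℝ) ∂(ν.law A T) ≤
      59904 * (Real.log T / ν.minGap i + M * ν.minGap i) := by
  have hT2 : 2 ≤ T := by omega
  have hL := Real.log_natCast_nonneg T
  have hmin := ν.lt_minGap hν hM hi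
  have hmin0 : 0 < ν.minGap i := by linarith
  have h1 := ν.integral_count_le A hT hM hA Finset.univ i
    (B := 29952 * Real.log T / ν.minGap i ^ 2) (by positivity) fun k _ h hg q _ hu => by
      have hq := ν.minGap_le q i
      rw [le_div_iff₀ (by positivity)]
      refine le_trans ?_ (ν.count_univ_mul_gap_sq_le hT2 hε hν hg hu (hmin.trans_le hq))
      gcongr
  have hsum : ∫ h, (count Finset.univ i h : ℝ) ∂(ν.law A T) =
      ∑ p, ∫ h, (h.pulls p i : ℝ) ∂(ν.law A T) := by
    simp only [count, Nat.cast_sum]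
    exact integral_finsetSum _ fun p _ => ν.integrable_pulls A p i
  rw [hsum, Finset.card_univ, Fintype.card_fin] at h1
  -- All gaps of a subpar arm are comparable to the smallest one, so only the total number of pulls
  -- matters.
  calc _ ≤ ∑ p, 2 * ν.minGap i * ∫ h, (h.pulls p i : ℝ) ∂(ν.law A T) :=
        Finset.sum_le_sum fun p _ => mul_le_mul_of_nonneg_right
          (ν.gap_le_two_mul_minGap hν hM hε hi p) (integral_nonneg fun h => Nat.cast_nonneg _)
    _ ≤ 2 * ν.minGap i * (29952 * Real.log T / ν.minGap i ^ 2 + 2 * M) := by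
        rw [← Finset.mul_sum]
        exact mul_le_mul_of_nonneg_left h1 (by positivity)
    _ = 59904 * (Real.log T / ν.minGap i) + 4 * (M * ν.minGap i) := by field_simp; ring
    _ ≤ _ := by
        have : 0 ≤ M * ν.minGap i := by positivity
        linarith

end MPMAB

theorem theorem1 :
    ∃ C : ℝ, 0 < C ∧
      ∀ (M K T : ℕ) (ε : ℝ), 0 < M → 0 < K → max M K < T → 0 ≤ ε → ε ≤ 1 →
      ∀ ν : MPMAB M K, ν.IsDissimilar ε →
      ∀ A : BanditAlgorithm M K, A.IsRobustAgg T ε →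
        ν.expectedCollectiveRegret A T ≤
          C * (∑ i ∈ ν.subpar ε, (Real.log T / ν.minGap i + M * ν.minGap i) +
            ∑ i ∈ (ν.subpar ε)ᶜ,
              ∑ p ∈ Finset.univ.filter (fun p : Fin M => 0 < ν.gap p i),
                Real.log T / ν.gap p i) := by
  refine ⟨59904, by norm_num, fun M K T ε hM _ hT hε _ ν hν A hA => ?_⟩
  have hL := Real.log_natCast_nonneg T
  unfold MPMAB.expectedCollectiveRegret MPMAB.expectedRegret
  rw [Finset.sum_comm, ← Finset.sum_add_sum_compl (ν.subpar ε), mul_add, Finset.mul_sum,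
    Finset.mul_sum]
  refine add_le_add (Finset.sum_le_sum fun i hi =>
    ν.sum_gap_mul_integral_pulls_le A hT hM hε hν hA hi) (Finset.sum_le_sum fun i _ => ?_)
  rw [Finset.mul_sum, Finset.sum_filter]
  refine Finset.sum_le_sum fun p _ => ?_
  split_ifs with hgap
  · refine (ν.gap_mul_integral_pulls_le A hT hM hε hν hA hgap).trans ?_
    have : 0 ≤ Real.log T / ν.gap p i := by positivity
    linarith
  · rw [le_antisymm (not_lt.1 hgap) (ν.gap_nonneg p i), zero_mul]
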